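/- **Notions.** A $3$-polygraph $\Sigma$ consists of a graph ($0$-cells $\Sigma_0$, generating $1$-cells $\Sigma_1$), a family $\Sigma_2$ of pairs of parallel $1$-cells of the free category on it (the generating $2$-cells), and a family $\Sigma_3$ of pairs $\alpha=(s\alpha,t\alpha)$ of parallel $2$-cells of the free strict $2$-category $\Sigma_2^*$ so generated (the generating $3$-cells). Let $\Sigma^*$ be the free strict $3$-category generated by $\Sigma$. A $2$-cell $f$ of $\Sigma_2^*$ *reduces* into $g$ if $\Sigma^*$ has a $3$-cell $f\Rrightarrow g$ that is not an identity; $\Sigma$ *terminates* if there is no infinite sequence $(f_n)_{n\in\mathbb N}$ of $2$-cells such that $f_n$ reduces into $f_{n+1}$ for every $n$. Compositions $\star_0$ (along $0$-cells) and $\star_1$ (along $1$-cells) are written in diagrammatic order. Let $\mathbf{Ord}$ be the category of partially ordered sets and monotone maps, viewed as a $2$-category with one $0$-cell, posets as $1$-cells composed by cartesian product, and monotone maps as $2$-cells composed by composition of maps; $2$-functors into it preserve the composition of $1$-cells up to coherent natural isomorphism (the cartesian product being associative and unital up to canonical isomorphism), and the isomorphisms $X(u\star_0 v)\cong X(u)\times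 X(v)$ are treated as identifications. For a $2$-category $\mathcal C$, $\mathcal C^{\mathrm{co}}$ is $\mathcal C$ with its $2$-cells reversed. An ordered abelian group is an abelian group with a partial order for which addition is (equivalently, strictly) monotone in each argument. Given $2$-functors $X:\Sigma_2^*\to\mathbf{Ord}$ and $Y:(\Sigma_2^*)^{\mathrm{co}}\to\mathbf{Ord}$ and an ordered abelian group $G$, let $M_{X,Y,G}(f)$, for a $2$-cell $f:u\Rightarrow v$, be the set of monotone maps $X(u)\times Y(v)\to G$ with pointwise addition. A *derivation* $d$ of $\Sigma_2^*$ into $M_{X,Y,G}$ assigns to every $2$-cell $f$ an element $d(f)$ of $M_{X,Y,G}(f)$ such that $d(f\star_i g)=f\star_i d(g)+d(f)\star_i g$ for $i\in\{0,1\}$ and all $i$-composable $f,g$; explicitly, $$d(f\star_1 g)(x,y)=d(g)\big(X(f)(x),y\big)+d(f)\big(x,Y(g)(y)\big),$$ $$d(f\star_0 g)\big((x,x'),(y,y')\big)=d(g)(x',y')+d(f)(x,y).$$ **Theorem.** Let $\Sigma$ be a $3$-polygraph such that there exist: * two $2$-functors $X:\Sigma_2^*\to\mathbf{Ord}$ and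 $Y:(\Sigma_2^*)^{\mathrm{co}}\to\mathbf{Ord}$ such that the posets $X(a)$ and $Y(a)$ are non-empty for every generating $1$-cell $a\in\Sigma_1$, and $X(s\alpha)\geq X(t\alpha)$ and $Y(s\alpha)\geq Y(t\alpha)$ hold pointwise for every $\alpha\in\Sigma_3$; * an ordered abelian group $G$ such that every (weakly) decreasing sequence of non-negative elements of $G$ is eventually constant; * a derivation $d$ of $\Sigma_2^*$ into $M_{X,Y,G}$ such that $d(f)(x,y)\geq 0$ for every $2$-cell $f:u\Rightarrow v$ of $\Sigma_2^*$ and all $(x,y)\in X(u)\times Y(v)$, and $d(s\alpha)(x,y)>d(t\alpha)(x,y)$ for every $\alpha\in\Sigma_3$, with $s\alpha:u\Rightarrow v$, and all $(x,y)\in X(u)\times Y(v)$. Then the $3$-polygraph $\Sigma$ terminates. -/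

import Mathlib

open CategoryTheory Bicategory

universe u₀ u₁ u₂ u₃ w₁ w₂ w₃ v₁ v₂ v₃

/-! ### Horizontal composition and the 2-cell dual -/

namespace CategoryTheory.Bicategory

/-- The composite `f ⋆₀ g` of two 2-cells along a 0-cell. The composite `⋆₁` along a 1-cell
is `f ≫ g`; both are written in the diagrammatic order. -/
def hcomp {C : Type v₁} [Bicategory.{v₃, v₂} C] {p q r : C} {u v : p ⟶ q} {u' v' : q ⟶ r}
    (f : u ⟶ v) (g : u' ⟶ v') : u ≫ u' ⟶ v ≫ v' :=
  f ▷ u' ≫ v ◁ g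

end CategoryTheory.Bicategory

/-- The dual `C^co`: same 0-cells and 1-cells as `C`, reversed 2-cells.
The 1-cell `u` of `C` is written `Opposite.op u` in `Co C`, the 2-cell `f` is written `f.op`. -/
structure Co (C : Type v₁) where
  /-- The 0-cell of `C^co` given by a 0-cell of `C`. -/
  of ::
  /-- The underlying 0-cell of `C`. -/
  as : C

namespace Co

variable {C : Type v₁} [Bicategory.{v₃, v₂} C]

instance : Bicategory.{v₃, v₂} (Co C) where
  Hom p q := (p.as ⟶ q.as)ᵒᵖ
  id p := Opposite.op (𝟙 p.as)
  comp u v := Opposite.op (u.unop ≫ v.unop)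
  homCategory p q := inferInstanceAs (Category (p.as ⟶ q.as)ᵒᵖ)
  whiskerLeft u _ _ η := (u.unop ◁ η.unop).op
  whiskerRight η v := (η.unop ▷ v.unop).op
  associator u v w := (α_ u.unop v.unop w.unop).symm.op
  leftUnitor u := (λ_ u.unop).symm.op
  rightUnitor u := (ρ_ u.unop).symm.op
  whiskerLeft_id _ _ := Quiver.Hom.unop_inj (by simp)
  whiskerLeft_comp _ _ _ _ _ _ := Quiver.Hom.unop_inj (by simp)
  id_whiskerLeft _ := Quiver.Hom.unop_inj (by simp)
  comp_whiskerLeft _ _ _ _ _ := Quiver.Hom.unop_inj (by simp)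
  id_whiskerRight _ _ := Quiver.Hom.unop_inj (by simp)
  comp_whiskerRight _ _ _ := Quiver.Hom.unop_inj (by simp)
  whiskerRight_id _ := Quiver.Hom.unop_inj (by simp)
  whiskerRight_comp _ _ _ := Quiver.Hom.unop_inj (by simp)
  whisker_assoc _ _ _ _ _ := Quiver.Hom.unop_inj (by simp)
  whisker_exchange _ _ := Quiver.Hom.unop_inj (by simp [whisker_exchange])
  pentagon _ _ _ _ := Quiver.Hom.unop_inj (by simp)
  triangle _ _ := Quiver.Hom.unop_inj (by simp)

end Co

/-! ### Partially ordered sets as a 2-category with one 0-cell -/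

namespace PartOrd

/-- The one-point poset is terminal. -/
def punitIsTerminal : Limits.IsTerminal (PartOrd.of PUnit.{w₁ + 1}) :=
  Limits.IsTerminal.ofUniqueHom (fun _ => PartOrd.ofHom ⟨fun _ => PUnit.unit, fun _ _ _ => le_rfl⟩)
    (fun _ _ => rfl)

/-- The cartesian product with the componentwise order. -/
def prodCone (A B : PartOrd.{w₁}) : Limits.BinaryFan A B :=
  .mk (P := PartOrd.of (A × B)) (PartOrd.ofHom OrderHom.fst) (PartOrd.ofHom OrderHom.snd)

/-- It is a categorical product. -/
def isLimitProdCone (A B : PartOrd.{w₁}) : Limits.IsLimit (prodCone A B) :=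
  Limits.BinaryFan.isLimitMk
    (fun s => PartOrd.ofHom (s.fst.hom.prod s.snd.hom)) (fun _ => rfl) (fun _ => rfl)
    (fun _ _ h₁ h₂ => PartOrd.ext fun x =>
      Prod.ext (ConcreteCategory.congr_hom h₁ x) (ConcreteCategory.congr_hom h₂ x))

/-- The tensor product of posets is the cartesian product `A × B`. -/
instance : CartesianMonoidalCategory PartOrd.{w₁} :=
  .ofChosenFiniteProducts ⟨_, punitIsTerminal⟩ fun A B =>
    { cone := prodCone A B, isLimit := isLimitProdCone A B }

end PartOrd

/-- A 2-functor from `C` to **Ord**, seen as a 2-category with one 0-cell: 1-cells are posets,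
composed by cartesian product, and 2-cells are monotone maps. As the cartesian product of sets
is associative and unital only up to canonical isomorphism, so is the preservation of the
composition of 1-cells. -/
abbrev OrdFunctor (C : Type v₁) [Bicategory.{v₃, v₂} C] :=
  Pseudofunctor C (MonoidalSingleObj PartOrd.{w₁})

namespace OrdFunctor

variable {C : Type v₁} [Bicategory.{v₃, v₂} C] (X : OrdFunctor.{w₁} C)

/-- The poset `X(u)`, for a 1-cell `u`. -/
def ord {p q : C} (u : p ⟶ q) : PartOrd.{w₁} := X.map u

/-- The monotone map `X(f) : X(u) → X(v)`, for a 2-cell `f : u ⇒ v`. -/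
def ordMap {p q : C} {u v : p ⟶ q} (f : u ⟶ v) : X.ord u →o X.ord v :=
  PartOrd.Hom.hom (X := X.ord u) (Y := X.ord v) (X.map₂ f)

/-- The identification `X(u ⋆₀ v) = X(u) × X(v)`. -/
def split {p q r : C} (u : p ⟶ q) (v : q ⟶ r) : X.ord (u ≫ v) →o X.ord u × X.ord v :=
  PartOrd.Hom.hom (X := X.ord (u ≫ v)) (Y := PartOrd.of (X.ord u × X.ord v)) (X.mapComp u v).hom

variable (Y : OrdFunctor.{w₂} (Co C))

/-- The poset `Y(v)`, for a 2-functor `Y` on `C^co` and a 1-cell `v` of `C`. -/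
def coOrd {p q : C} (v : p ⟶ q) : PartOrd.{w₂} :=
  Y.ord (p := .of p) (q := .of q) (Opposite.op v)

/-- The monotone map `Y(f) : Y(v) → Y(u)`, for a 2-cell `f : u ⇒ v` of `C`. -/
def coMap {p q : C} {u v : p ⟶ q} (f : u ⟶ v) : Y.coOrd v →o Y.coOrd u :=
  Y.ordMap (p := .of p) (q := .of q) (u := Opposite.op v) (v := Opposite.op u) f.op

/-- The identification `Y(u ⋆₀ v) = Y(u) × Y(v)`. -/
def coSplit {p q r : C} (u : p ⟶ q) (v : q ⟶ r) :
    Y.coOrd (u ≫ v) →o Y.coOrd u × Y.coOrd v :=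
  Y.split (p := .of p) (q := .of q) (r := .of r) (Opposite.op u) (Opposite.op v)

end OrdFunctor

/-! ### The module `M_{X,Y,G}` and derivations -/

section Derivations

variable {C : Type v₁} [Bicategory.{v₃, v₂} C]

/-- The value `M_{X,Y,G}(f)` at a 2-cell `f : u ⇒ v`: the monotone maps `X(u) × Y(v) → G`,
with pointwise addition (opposites of monotone maps need not be monotone, and are not used). -/
def ModXYG (X : OrdFunctor.{w₁} C) (Y : OrdFunctor.{w₂} (Co C)) (G : Type w₃) [PartialOrder G]
    {p q : C} {u v : p ⟶ q} (_f : u ⟶ v) :=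
  X.ord u × Y.coOrd v →o G

namespace ModXYG

variable {X : OrdFunctor.{w₁} C} {Y : OrdFunctor.{w₂} (Co C)} {G : Type w₃} [PartialOrder G]
variable {p q r : C}

/-- The value `a(x, y)`. -/
def eval {u v : p ⟶ q} {f : u ⟶ v} (a : ModXYG X Y G f) (x : X.ord u)
    (y : Y.coOrd v) : G :=
  OrderHom.toFun a (x, y)

/-- Pointwise addition. -/
instance [AddCommGroup G] [IsOrderedAddMonoid G] {u v : p ⟶ q} (f : u ⟶ v) :
    Add (ModXYG X Y G f) where
  add a b :=
    ⟨fun z => a.eval z.1 z.2 + b.eval z.1 z.2, fun _ _ h => add_le_add (a.monotone' h) (b.monotone' h)⟩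

/-- `w ⋆₀ a`, for a 1-cell `w`: the map `((x', x), (y', y)) ↦ a(x, y)`. -/
def whiskerLeft (w : p ⟶ q) {u v : q ⟶ r} {f : u ⟶ v} (a : ModXYG X Y G f) :
    ModXYG X Y G (w ◁ f) :=
  OrderHom.comp a <| OrderHom.prodMap
    (OrderHom.snd.comp (X.split w u))
    (OrderHom.snd.comp (Y.coSplit w v))

/-- `a ⋆₀ w`, for a 1-cell `w`: the map `((x, x''), (y, y'')) ↦ a(x, y)`. -/
def whiskerRight {u v : p ⟶ q} {f : u ⟶ v} (a : ModXYG X Y G f) (w : q ⟶ r) :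
    ModXYG X Y G (f ▷ w) :=
  OrderHom.comp a <| OrderHom.prodMap
    (OrderHom.fst.comp (X.split u w))
    (OrderHom.fst.comp (Y.coSplit v w))

/-- `g ⋆₁ a`, for a 2-cell `g`: the map `(x, y) ↦ a(X(g)(x), y)`. -/
def left₁ {u' u v : p ⟶ q} (g : u' ⟶ u) {f : u ⟶ v} (a : ModXYG X Y G f) :
    ModXYG X Y G (g ≫ f) :=
  OrderHom.comp a <| OrderHom.prodMap (X.ordMap g) OrderHom.id

/-- `a ⋆₁ h`, for a 2-cell `h`: the map `(x, y) ↦ a(x, Y(h)(y))`. -/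
def right₁ {u v v' : p ⟶ q} {f : u ⟶ v} (a : ModXYG X Y G f) (h : v ⟶ v') :
    ModXYG X Y G (f ≫ h) :=
  OrderHom.comp a <| OrderHom.prodMap OrderHom.id
    (Y.coMap h)

/-- `g ⋆₀ a`, for a 2-cell `g : w ⇒ w'`: the context `g ⋆₀ x` on a 2-cell `u ⇒ v` is
`(g ⋆₀ u) ⋆₁ (w' ⋆₀ x)`. -/
def left₀ {w w' : p ⟶ q} (g : w ⟶ w') {u v : q ⟶ r} {f : u ⟶ v} (a : ModXYG X Y G f) :
    ModXYG X Y G (hcomp g f) :=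
  left₁ (g ▷ u) (whiskerLeft w' a)

/-- `a ⋆₀ g`, for a 2-cell `g : w ⇒ w'`: the context `x ⋆₀ g` on a 2-cell `u ⇒ v` is
`(x ⋆₀ w) ⋆₁ (v ⋆₀ g)`. -/
def right₀ {u v : p ⟶ q} {f : u ⟶ v} (a : ModXYG X Y G f) {w w' : q ⟶ r} (g : w ⟶ w') :
    ModXYG X Y G (hcomp f g) :=
  right₁ (whiskerRight a w) (v ◁ g)

end ModXYG

/-- Derivations of the 2-category `C` into `M_{X,Y,G}`. -/
structure Derivation₂ (X : OrdFunctor.{w₁} C) (Y : OrdFunctor.{w₂} (Co C)) (G : Type w₃)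
    [AddCommGroup G] [PartialOrder G] [IsOrderedAddMonoid G] where
  /-- The value `d(f)` at a 2-cell `f`. -/
  d : ∀ {p q : C} {u v : p ⟶ q} (f : u ⟶ v), ModXYG X Y G f
  /-- `d(f ⋆₁ g) = f ⋆₁ d(g) + d(f) ⋆₁ g`. -/
  d_comp₁ : ∀ {p q : C} {u v w : p ⟶ q} (f : u ⟶ v) (g : v ⟶ w),
    d (f ≫ g) = ModXYG.left₁ f (d g) + ModXYG.right₁ (d f) g
  /-- `d(f ⋆₀ g) = f ⋆₀ d(g) + d(f) ⋆₀ g`. -/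
  d_comp₀ : ∀ {p q r : C} {u v : p ⟶ q} {u' v' : q ⟶ r} (f : u ⟶ v) (g : u' ⟶ v'),
    d (hcomp f g) = ModXYG.left₀ f (d g) + ModXYG.right₀ (d f) g

end Derivations

/-! ### Polygraphs -/

/-- A 1-polygraph: 0-cells and generating 1-cells between them. -/
structure Polygraph₁ where
  /-- The 0-cells. -/
  Cell₀ : Type u₀
  /-- The generating 1-cells with given source and target. -/
  Cell₁ : Cell₀ → Cell₀ → Type u₁

/-- The generating graph of a 1-polygraph. -/
instance (S : Polygraph₁.{u₀, u₁}) : Quiver S.Cell₀ := ⟨S.Cell₁⟩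

/-- The 1-cells of the free category on a 1-polygraph: the paths of its generating graph. -/
abbrev Polygraph₁.Path (S : Polygraph₁.{u₀, u₁}) (p q : S.Cell₀) : Type (max u₀ u₁) :=
  Quiver.Path p q

/-- A 2-polygraph: a 1-polygraph with a family of 1-spheres (pairs of parallel 1-cells) of the
free category on it. -/
structure Polygraph₂ extends Polygraph₁.{u₀, u₁} where
  /-- The generating 2-cells with given source and target. -/
  Cell₂ : ∀ {p q : Cell₀}, toPolygraph₁.Path p q → toPolygraph₁.Path p q → Type u₂

namespace Polygraph₂

variable (S : Polygraph₂.{u₀, u₁, u₂})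

/-- Formal composites of generating 2-cells. -/
inductive Term : ∀ {p q : S.Cell₀}, Quiver.Path p q → Quiver.Path p q → Type (max u₀ u₁ u₂)
  | gen {p q : S.Cell₀} {u v : Quiver.Path p q} (φ : S.Cell₂ u v) : Term u v
  | id {p q : S.Cell₀} (u : Quiver.Path p q) : Term u u
  | comp₁ {p q : S.Cell₀} {u v w : Quiver.Path p q} (f : Term u v) (g : Term v w) : Term u w
  | comp₀ {p q r : S.Cell₀} {u v : Quiver.Path p q} {u' v' : Quiver.Path q r}
      (f : Term u v) (g : Term u' v') : Term (u.comp u') (v.comp v')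

open Term in
/-- The congruence generated by the axioms of (strict) 2-categories. It is stated between terms
whose boundaries may differ as expressions, such as `(u ⋆₀ v) ⋆₀ w` and `u ⋆₀ (v ⋆₀ w)`; related
terms always have equal boundaries. -/
inductive Rel : ∀ {p q : S.Cell₀} {u v : Quiver.Path p q} {p' q' : S.Cell₀}
    {u' v' : Quiver.Path p' q'}, S.Term u v → S.Term u' v' → Prop
  | refl {p q : S.Cell₀} {u v : Quiver.Path p q} (f : S.Term u v) : Rel f f
  | symm {p q : S.Cell₀} {u v : Quiver.Path p q} {p' q' : S.Cell₀} {u' v' : Quiver.Path p' q'}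
      {f : S.Term u v} {g : S.Term u' v'} : Rel f g → Rel g f
  | trans {p q : S.Cell₀} {u v : Quiver.Path p q} {p' q' : S.Cell₀} {u' v' : Quiver.Path p' q'}
      {p'' q'' : S.Cell₀} {u'' v'' : Quiver.Path p'' q''}
      {f : S.Term u v} {g : S.Term u' v'} {h : S.Term u'' v''} : Rel f g → Rel g h → Rel f h
  | congr₁ {p q : S.Cell₀} {u v w : Quiver.Path p q} {p' q' : S.Cell₀}
      {u' v' w' : Quiver.Path p' q'} {f : S.Term u v} {g : S.Term v w}
      {f' : S.Term u' v'} {g' : S.Term v' w'} :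
      Rel f f' → Rel g g' → Rel (comp₁ f g) (comp₁ f' g')
  | congr₀ {p q r : S.Cell₀} {u v : Quiver.Path p q} {x y : Quiver.Path q r}
      {p' q' r' : S.Cell₀} {u' v' : Quiver.Path p' q'} {x' y' : Quiver.Path q' r'}
      {f : S.Term u v} {g : S.Term x y} {f' : S.Term u' v'} {g' : S.Term x' y'} :
      Rel f f' → Rel g g' → Rel (comp₀ f g) (comp₀ f' g')
  | id_comp₁ {p q : S.Cell₀} {u v : Quiver.Path p q} (f : S.Term u v) : Rel (comp₁ (id u) f) f
  | comp₁_id {p q : S.Cell₀} {u v : Quiver.Path p q} (f : S.Term u v) : Rel (comp₁ f (id v)) f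
  | assoc₁ {p q : S.Cell₀} {u v w x : Quiver.Path p q} (f : S.Term u v) (g : S.Term v w)
      (h : S.Term w x) : Rel (comp₁ (comp₁ f g) h) (comp₁ f (comp₁ g h))
  | id_comp₀ {p q : S.Cell₀} {u v : Quiver.Path p q} (f : S.Term u v) :
      Rel (comp₀ (id (Quiver.Path.nil : Quiver.Path p p)) f) f
  | comp₀_id {p q : S.Cell₀} {u v : Quiver.Path p q} (f : S.Term u v) :
      Rel (comp₀ f (id (Quiver.Path.nil : Quiver.Path q q))) f
  | assoc₀ {p q r s : S.Cell₀} {u v : Quiver.Path p q} {u' v' : Quiver.Path q r}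
      {u'' v'' : Quiver.Path r s} (f : S.Term u v) (g : S.Term u' v') (h : S.Term u'' v'') :
      Rel (comp₀ (comp₀ f g) h) (comp₀ f (comp₀ g h))
  | id_comp₀_id {p q r : S.Cell₀} (u : Quiver.Path p q) (v : Quiver.Path q r) :
      Rel (comp₀ (id u) (id v)) (id (u.comp v))
  | exchange {p q r : S.Cell₀} {u v w : Quiver.Path p q} {u' v' w' : Quiver.Path q r}
      (f : S.Term u v) (g : S.Term v w) (f' : S.Term u' v') (g' : S.Term v' w') :
      Rel (comp₀ (comp₁ f g) (comp₁ f' g')) (comp₁ (comp₀ f f') (comp₀ g g'))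

/-- The 2-category freely generated by a 2-polygraph, through its 0-cells. -/
structure Free where
  /-- The 0-cell of the free 2-category given by a 0-cell of the polygraph. -/
  of ::
  /-- The underlying 0-cell. -/
  as : S.Cell₀

namespace Free

/-- The 2-cells: formal composites modulo the axioms of 2-categories. -/
def Hom₂ {p q : S.Cell₀} (u v : Quiver.Path p q) : Type (max u₀ u₁ u₂) :=
  Quot (fun f g : S.Term u v => S.Rel f g)

variable {S}

/-- The 2-cell represented by a term. -/
def mk {p q : S.Cell₀} {u v : Quiver.Path p q} (f : S.Term u v) : Hom₂ S u v := Quot.mk _ f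

/-- The composition `⋆₁`. -/
def vcomp {p q : S.Cell₀} {u v w : Quiver.Path p q} (f : Hom₂ S u v) (g : Hom₂ S v w) :
    Hom₂ S u w :=
  Quot.map₂ Term.comp₁ (fun _ _ _ h => .congr₁ (.refl _) h) (fun _ _ _ h => .congr₁ h (.refl _)) f g

/-- The composition `⋆₀`. -/
def comp₀ {p q r : S.Cell₀} {u v : Quiver.Path p q} {u' v' : Quiver.Path q r}
    (f : Hom₂ S u v) (g : Hom₂ S u' v') : Hom₂ S (u.comp u') (v.comp v') :=
  Quot.map₂ Term.comp₀ (fun _ _ _ h => .congr₀ (.refl _) h) (fun _ _ _ h => .congr₀ h (.refl _)) f g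

instance : CategoryStruct (Free S) where
  Hom p q := Quiver.Path p.as q.as
  id p := Quiver.Path.nil
  comp u v := Quiver.Path.comp u v

instance {a b : Free S} : Category (a ⟶ b) where
  Hom u v := Hom₂ S u v
  id u := mk (.id u)
  comp f g := vcomp f g
  id_comp := by rintro u v ⟨f⟩; exact Quot.sound (.id_comp₁ f)
  comp_id := by rintro u v ⟨f⟩; exact Quot.sound (.comp₁_id f)
  assoc := by rintro u v w x ⟨f⟩ ⟨g⟩ ⟨h⟩; exact Quot.sound (.assoc₁ f g h)

theorem mk_eq {p q : Free S} {u v u' v' : p ⟶ q} {f : S.Term u v} {g : S.Term u' v'}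
    (h : S.Rel f g) (hu : u = u') (hv : v = v') :
    (mk f : u ⟶ v) = eqToHom hu ≫ (mk g : u' ⟶ v') ≫ eqToHom hv.symm := by
  subst hu hv
  have h' : mk f = mk g := Quot.sound h
  rw [h', eqToHom_refl, eqToHom_refl, Category.id_comp, Category.comp_id]

theorem comp₀_id_eqToHom {p q r : Free S} (w : p ⟶ q) {u v : q ⟶ r} (h : u = v) :
    (comp₀ (mk (.id w)) (eqToHom h : u ⟶ v) : w ≫ u ⟶ w ≫ v) = eqToHom (congrArg (w ≫ ·) h) := by
  subst h
  exact Quot.sound (.id_comp₀_id w u)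

theorem comp₀_eqToHom_id {p q r : Free S} {u v : p ⟶ q} (h : u = v) (w : q ⟶ r) :
    (comp₀ (eqToHom h : u ⟶ v) (mk (.id w)) : u ≫ w ⟶ v ≫ w) = eqToHom (congrArg (· ≫ w) h) := by
  subst h
  exact Quot.sound (.id_comp₀_id u w)

theorem path_id_comp {p q : Free S} (u : p ⟶ q) : 𝟙 p ≫ u = u := Quiver.Path.nil_comp u

theorem path_comp_id {p q : Free S} (u : p ⟶ q) : u ≫ 𝟙 q = u := Quiver.Path.comp_nil u

theorem path_assoc {p q r s : Free S} (u : p ⟶ q) (v : q ⟶ r) (w : r ⟶ s) :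
    (u ≫ v) ≫ w = u ≫ v ≫ w := Quiver.Path.comp_assoc u v w

instance : Bicategory (Free S) where
  homCategory := inferInstance
  whiskerLeft u _ _ f := comp₀ (mk (.id u)) f
  whiskerRight f w := comp₀ f (mk (.id w))
  associator u v w := eqToIso (path_assoc u v w)
  leftUnitor u := eqToIso (path_id_comp u)
  rightUnitor u := eqToIso (path_comp_id u)
  whiskerLeft_id u v := Quot.sound (.id_comp₀_id u v)
  whiskerLeft_comp := by
    rintro p q r u v w x ⟨f⟩ ⟨g⟩
    exact Quot.sound (.trans (.congr₀ (.symm (.id_comp₁ _)) (.refl _)) (.exchange _ _ _ _))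
  id_whiskerLeft := by
    rintro p q u v ⟨f⟩
    exact mk_eq (.id_comp₀ f) (path_id_comp _) (path_id_comp _)
  comp_whiskerLeft := by
    rintro p q r s u v w x ⟨f⟩
    exact mk_eq (.trans (.congr₀ (.symm (.id_comp₀_id u v)) (.refl f)) (.assoc₀ _ _ f))
      (path_assoc _ _ _) (path_assoc _ _ _)
  id_whiskerRight u v := Quot.sound (.id_comp₀_id u v)
  comp_whiskerRight := by
    rintro p q r u v w ⟨f⟩ ⟨g⟩ x
    exact Quot.sound (.trans (.congr₀ (.refl _) (.symm (.id_comp₁ _))) (.exchange _ _ _ _))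
  whiskerRight_id := by
    rintro p q u v ⟨f⟩
    exact mk_eq (.comp₀_id f) (path_comp_id _) (path_comp_id _)
  whiskerRight_comp := by
    rintro p q r s u v ⟨f⟩ w x
    exact mk_eq (.trans (.congr₀ (.refl f) (.symm (.id_comp₀_id w x))) (.symm (.assoc₀ f _ _)))
      (path_assoc _ _ _).symm (path_assoc _ _ _).symm
  whisker_assoc := by
    rintro p q r s u v w ⟨f⟩ x
    exact mk_eq (.assoc₀ _ f _) (path_assoc _ _ _) (path_assoc _ _ _)
  whisker_exchange := by
    rintro p q r u v w x ⟨f⟩ ⟨g⟩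
    refine Quot.sound (.trans (.symm (.exchange _ _ _ _)) (.trans (.congr₀ ?_ ?_)
      (.exchange _ _ _ _)))
    · exact .trans (.id_comp₁ _) (.symm (.comp₁_id _))
    · exact .trans (.comp₁_id _) (.symm (.id_comp₁ _))
  pentagon u v w x := by
    simp only [eqToIso.hom]
    rw [comp₀_eqToHom_id, comp₀_id_eqToHom]
    simp
  triangle u v := by
    simp only [eqToIso.hom]
    rw [comp₀_eqToHom_id, comp₀_id_eqToHom]
    simp

instance : Bicategory.Strict (Free S) where
  id_comp := path_id_comp
  comp_id := path_comp_id
  assoc := path_assoc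
  leftUnitor_eqToIso _ := rfl
  rightUnitor_eqToIso _ := rfl
  associator_eqToIso _ _ _ := rfl

/-- A generating 1-cell, as a 1-cell of the free 2-category. -/
def gen₁ {p q : S.Cell₀} (a : S.Cell₁ p q) : Free.of p ⟶ Free.of q :=
  Quiver.Hom.toPath (V := S.Cell₀) a

end Free

end Polygraph₂

/-- A 3-polygraph: a 2-polygraph with a family of 2-spheres (pairs of parallel 2-cells) of the
free 2-category on it. -/
structure Polygraph₃ extends Polygraph₂.{u₀, u₁, u₂} where
  /-- The generating 3-cells with given source and target. -/
  Cell₃ : ∀ {p q : toPolygraph₂.Free} {u v : p ⟶ q}, (u ⟶ v) → (u ⟶ v) → Type u₃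

namespace Polygraph₃

variable (S : Polygraph₃.{u₀, u₁, u₂, u₃})

/-- The free 2-category on the underlying 2-polygraph. -/
abbrev Free₂ := S.toPolygraph₂.Free

/-- Formal composites of generating 3-cells. -/
inductive Term : ∀ {p q : S.Free₂} {u v : p ⟶ q}, (u ⟶ v) → (u ⟶ v) → Type (max u₀ u₁ u₂ u₃)
  | gen {p q : S.Free₂} {u v : p ⟶ q} {f g : u ⟶ v} (α : S.Cell₃ f g) : Term f g
  | id {p q : S.Free₂} {u v : p ⟶ q} (f : u ⟶ v) : Term f f
  | comp₂ {p q : S.Free₂} {u v : p ⟶ q} {f g h : u ⟶ v} (A : Term f g) (B : Term g h) : Term f h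
  | comp₁ {p q : S.Free₂} {u v w : p ⟶ q} {f f' : u ⟶ v} {g g' : v ⟶ w}
      (A : Term f f') (B : Term g g') : Term (f ≫ g) (f' ≫ g')
  | comp₀ {p q r : S.Free₂} {u v : p ⟶ q} {x y : q ⟶ r} {f f' : u ⟶ v} {g g' : x ⟶ y}
      (A : Term f f') (B : Term g g') : Term (hcomp f g) (hcomp f' g')

open Term in
/-- The congruence generated by the axioms of (strict) 3-categories, stated between terms whose
boundaries may differ as expressions; related terms always have equal boundaries. -/
inductive Rel : ∀ {p q : S.Free₂} {u v : p ⟶ q} {f g : u ⟶ v}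
    {p' q' : S.Free₂} {u' v' : p' ⟶ q'} {f' g' : u' ⟶ v'}, S.Term f g → S.Term f' g' → Prop
  | refl {p q : S.Free₂} {u v : p ⟶ q} {f g : u ⟶ v} (A : S.Term f g) : Rel A A
  | symm {p q : S.Free₂} {u v : p ⟶ q} {f g : u ⟶ v}
      {p' q' : S.Free₂} {u' v' : p' ⟶ q'} {f' g' : u' ⟶ v'}
      {A : S.Term f g} {B : S.Term f' g'} : Rel A B → Rel B A
  | trans {p q : S.Free₂} {u v : p ⟶ q} {f g : u ⟶ v}
      {p' q' : S.Free₂} {u' v' : p' ⟶ q'} {f' g' : u' ⟶ v'}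
      {p'' q'' : S.Free₂} {u'' v'' : p'' ⟶ q''} {f'' g'' : u'' ⟶ v''}
      {A : S.Term f g} {B : S.Term f' g'} {D : S.Term f'' g''} : Rel A B → Rel B D → Rel A D
  | congr₂ {p q : S.Free₂} {u v : p ⟶ q} {f g h : u ⟶ v}
      {p' q' : S.Free₂} {u' v' : p' ⟶ q'} {f' g' h' : u' ⟶ v'}
      {A : S.Term f g} {B : S.Term g h} {A' : S.Term f' g'} {B' : S.Term g' h'} :
      Rel A A' → Rel B B' → Rel (comp₂ A B) (comp₂ A' B')
  | congr₁ {p q : S.Free₂} {u v w : p ⟶ q} {f g : u ⟶ v} {h k : v ⟶ w}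
      {p' q' : S.Free₂} {u' v' w' : p' ⟶ q'} {f' g' : u' ⟶ v'} {h' k' : v' ⟶ w'}
      {A : S.Term f g} {B : S.Term h k} {A' : S.Term f' g'} {B' : S.Term h' k'} :
      Rel A A' → Rel B B' → Rel (comp₁ A B) (comp₁ A' B')
  | congr₀ {p q r : S.Free₂} {u v : p ⟶ q} {x y : q ⟶ r} {f g : u ⟶ v} {h k : x ⟶ y}
      {p' q' r' : S.Free₂} {u' v' : p' ⟶ q'} {x' y' : q' ⟶ r'} {f' g' : u' ⟶ v'} {h' k' : x' ⟶ y'}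
      {A : S.Term f g} {B : S.Term h k} {A' : S.Term f' g'} {B' : S.Term h' k'} :
      Rel A A' → Rel B B' → Rel (comp₀ A B) (comp₀ A' B')
  | id_comp₂ {p q : S.Free₂} {u v : p ⟶ q} {f g : u ⟶ v} (A : S.Term f g) :
      Rel (comp₂ (id f) A) A
  | comp₂_id {p q : S.Free₂} {u v : p ⟶ q} {f g : u ⟶ v} (A : S.Term f g) :
      Rel (comp₂ A (id g)) A
  | assoc₂ {p q : S.Free₂} {u v : p ⟶ q} {f g h k : u ⟶ v} (A : S.Term f g) (B : S.Term g h)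
      (D : S.Term h k) : Rel (comp₂ (comp₂ A B) D) (comp₂ A (comp₂ B D))
  | id_comp₁ {p q : S.Free₂} {u v : p ⟶ q} {f g : u ⟶ v} (A : S.Term f g) :
      Rel (comp₁ (id (𝟙 u)) A) A
  | comp₁_id {p q : S.Free₂} {u v : p ⟶ q} {f g : u ⟶ v} (A : S.Term f g) :
      Rel (comp₁ A (id (𝟙 v))) A
  | assoc₁ {p q : S.Free₂} {u v w x : p ⟶ q} {f f' : u ⟶ v} {g g' : v ⟶ w} {h h' : w ⟶ x}
      (A : S.Term f f') (B : S.Term g g') (D : S.Term h h') :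
      Rel (comp₁ (comp₁ A B) D) (comp₁ A (comp₁ B D))
  | id_comp₀ {p q : S.Free₂} {u v : p ⟶ q} {f g : u ⟶ v} (A : S.Term f g) :
      Rel (comp₀ (id (𝟙 (𝟙 p))) A) A
  | comp₀_id {p q : S.Free₂} {u v : p ⟶ q} {f g : u ⟶ v} (A : S.Term f g) :
      Rel (comp₀ A (id (𝟙 (𝟙 q)))) A
  | assoc₀ {p q r s : S.Free₂} {u v : p ⟶ q} {u' v' : q ⟶ r} {u'' v'' : r ⟶ s}
      {f g : u ⟶ v} {f' g' : u' ⟶ v'} {f'' g'' : u'' ⟶ v''}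
      (A : S.Term f g) (B : S.Term f' g') (D : S.Term f'' g'') :
      Rel (comp₀ (comp₀ A B) D) (comp₀ A (comp₀ B D))
  | id_comp₁_id {p q : S.Free₂} {u v w : p ⟶ q} (f : u ⟶ v) (g : v ⟶ w) :
      Rel (comp₁ (id f) (id g)) (id (f ≫ g))
  | id_comp₀_id {p q r : S.Free₂} {u v : p ⟶ q} {x y : q ⟶ r} (f : u ⟶ v) (g : x ⟶ y) :
      Rel (comp₀ (id f) (id g)) (id (hcomp f g))
  | exchange₁₂ {p q : S.Free₂} {u v w : p ⟶ q} {f f' f'' : u ⟶ v} {g g' g'' : v ⟶ w}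
      (A : S.Term f f') (A' : S.Term f' f'') (B : S.Term g g') (B' : S.Term g' g'') :
      Rel (comp₁ (comp₂ A A') (comp₂ B B')) (comp₂ (comp₁ A B) (comp₁ A' B'))
  | exchange₀₂ {p q r : S.Free₂} {u v : p ⟶ q} {x y : q ⟶ r} {f f' f'' : u ⟶ v}
      {g g' g'' : x ⟶ y}
      (A : S.Term f f') (A' : S.Term f' f'') (B : S.Term g g') (B' : S.Term g' g'') :
      Rel (comp₀ (comp₂ A A') (comp₂ B B')) (comp₂ (comp₀ A B) (comp₀ A' B'))
  | exchange₀₁ {p q r : S.Free₂} {u v w : p ⟶ q} {x y z : q ⟶ r} {f f' : u ⟶ v} {h h' : v ⟶ w}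
      {g g' : x ⟶ y} {k k' : y ⟶ z}
      (A : S.Term f f') (A' : S.Term h h') (B : S.Term g g') (B' : S.Term k k') :
      Rel (comp₀ (comp₁ A A') (comp₁ B B')) (comp₁ (comp₀ A B) (comp₀ A' B'))

/-- The 3-cells `f ⇛ g` of the free 3-category on a 3-polygraph. -/
def Hom₃ {p q : S.Free₂} {u v : p ⟶ q} (f g : u ⟶ v) : Type (max u₀ u₁ u₂ u₃) :=
  Quot (fun A B : S.Term f g => S.Rel A B)

variable {S}

/-- The identity 3-cell on a 2-cell. -/
def id₃ {p q : S.Free₂} {u v : p ⟶ q} (f : u ⟶ v) : S.Hom₃ f f := Quot.mk _ (.id f)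

/-- A 3-cell is degenerate when it is an identity. -/
def IsDegenerate {p q : S.Free₂} {u v : p ⟶ q} {f g : u ⟶ v} (A : S.Hom₃ f g) : Prop :=
  ∃ h : f = g, A = h ▸ id₃ f

variable (S)

/-- `f` reduces into `g` when there is a non-degenerate 3-cell from `f` to `g` in the free
3-category. -/
def Reduces {p q : S.Free₂} {u v : p ⟶ q} (f g : u ⟶ v) : Prop :=
  ∃ A : S.Hom₃ f g, ¬ IsDegenerate A

/-- There is no infinite reduction sequence starting at `f`. -/
def TerminatesAt {p q : S.Free₂} {u v : p ⟶ q} (f : u ⟶ v) : Prop :=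
  ¬ ∃ F : ℕ → (u ⟶ v), F 0 = f ∧ ∀ n, S.Reduces (F n) (F (n + 1))

/-- A 3-polygraph terminates when it does at every 2-cell of the free 2-category. -/
def Terminates : Prop :=
  ∀ {p q : S.Free₂} {u v : p ⟶ q} (f : u ⟶ v), S.TerminatesAt f

end Polygraph₃

/-!
Every 3-cell `f ⇛ g` weakly decreases `X` and `Y`, and either is an identity or makes the values
of the derivation decrease strictly at every point `(x, y)`. This is proved by induction on the
formal composites of generating 3-cells (`Polygraph₃.Term.ordMap_le`, `Polygraph₃.Term.coMap_le`,
`Polygraph₃.Term.degenerate_or_lt`). The explicit formulas for `d(f ⋆₁ g)` and `d(f ⋆₀ g)`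
(`Derivation₂.eval_comp`, `Derivation₂.eval_hcomp`) express their values through those of `d(f)`
and `d(g)`; in the case of `⋆₁`, the points of evaluation depend on `X(f)` and `Y(g)`, and are
controlled by the monotonicity of `d(f)` and `d(g)`. A composite of identities is an identity, so
that a composite which is not an identity has a factor on which the decrease is strict.

As the posets `X(a)` and `Y(a)` are non-empty on generators, so are all the `X(u)` and `Y(v)`.
Evaluating `d` at one point along an infinite reduction sequence thus gives a strictly decreasing
sequence of non-negative elements of `G`, which the hypothesis on `G` excludes.
-/

/-! ### 2-functors into posets -/

namespace OrdFunctor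

section Basic

variable {C : Type v₁} [Bicategory.{v₃, v₂} C] (X : OrdFunctor.{w₁} C)

theorem ordMap_comp {p q : C} {u v w : p ⟶ q} (f : u ⟶ v) (g : v ⟶ w) (x : X.ord u) :
    X.ordMap (f ≫ g) x = X.ordMap g (X.ordMap f x) := by
  have h := X.map₂_comp f g
  exact congrArg (fun k => PartOrd.Hom.hom (X := X.ord u) (Y := X.ord w) k x) h

/-- The naturality of `X.mapComp` in its first argument, read pointwise: the whiskerings of
`MonoidalSingleObj PartOrd` are definitionally products with an identity map. -/
theorem split_whiskerRight {p q r : C} {u v : p ⟶ q} (f : u ⟶ v) (w : q ⟶ r)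
    (x : X.ord (u ≫ w)) :
    X.split v w (X.ordMap (f ▷ w) x) = (X.ordMap f (X.split u w x).1, (X.split u w x).2) := by
  have h : X.map₂ (f ▷ w) ≫ (X.mapComp v w).hom = (X.mapComp u w).hom ≫ X.map₂ f ▷ X.map w := by
    simp
  exact congrArg (fun k => PartOrd.Hom.hom (X := X.ord (u ≫ w))
    (Y := PartOrd.of (X.ord v × X.ord w)) k x) h

theorem split_whiskerLeft {p q r : C} (w : p ⟶ q) {u v : q ⟶ r} (f : u ⟶ v)
    (x : X.ord (w ≫ u)) :
    X.split w v (X.ordMap (w ◁ f) x) = ((X.split w u x).1, X.ordMap f (X.split w u x).2) := by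
  have h : X.map₂ (w ◁ f) ≫ (X.mapComp w v).hom = (X.mapComp w u).hom ≫ X.map w ◁ X.map₂ f := by
    simp
  exact congrArg (fun k => PartOrd.Hom.hom (X := X.ord (w ≫ u))
    (Y := PartOrd.of (X.ord w × X.ord v)) k x) h

theorem split_hcomp {p q r : C} {u v : p ⟶ q} {u' v' : q ⟶ r} (f : u ⟶ v) (g : u' ⟶ v')
    (x : X.ord (u ≫ u')) :
    X.split v v' (X.ordMap (hcomp f g) x) =
      (X.ordMap f (X.split u u' x).1, X.ordMap g (X.split u u' x).2) := by
  rw [hcomp, ordMap_comp, split_whiskerLeft, split_whiskerRight]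

/-- The inverse of the identification `X(u ⋆₀ v) = X(u) × X(v)`. -/
def join {p q r : C} (u : p ⟶ q) (v : q ⟶ r) : X.ord u × X.ord v →o X.ord (u ≫ v) :=
  PartOrd.Hom.hom (X := PartOrd.of (X.ord u × X.ord v)) (Y := X.ord (u ≫ v)) (X.mapComp u v).inv

theorem join_split {p q r : C} (u : p ⟶ q) (v : q ⟶ r) (x : X.ord (u ≫ v)) :
    X.join u v (X.split u v x) = x := by
  have h := (X.mapComp u v).hom_inv_id
  exact congrArg (fun k => PartOrd.Hom.hom (X := X.ord (u ≫ v)) (Y := X.ord (u ≫ v)) k x) h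

theorem le_of_split_le {p q r : C} {u : p ⟶ q} {v : q ⟶ r} {x y : X.ord (u ≫ v)}
    (h : X.split u v x ≤ X.split u v y) : x ≤ y := by
  rw [← X.join_split u v x, ← X.join_split u v y]
  exact (X.join u v).monotone h

theorem ordMap_comp_le {p q : C} {u v w : p ⟶ q} {f f' : u ⟶ v} {g g' : v ⟶ w}
    (hf : X.ordMap f' ≤ X.ordMap f) (hg : X.ordMap g' ≤ X.ordMap g) :
    X.ordMap (f' ≫ g') ≤ X.ordMap (f ≫ g) := fun x => by
  rw [ordMap_comp, ordMap_comp]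
  exact ((X.ordMap g').monotone (hf x)).trans (hg _)

theorem ordMap_hcomp_le {p q r : C} {u v : p ⟶ q} {u' v' : q ⟶ r} {f f' : u ⟶ v}
    {g g' : u' ⟶ v'} (hf : X.ordMap f' ≤ X.ordMap f) (hg : X.ordMap g' ≤ X.ordMap g) :
    X.ordMap (hcomp f' g') ≤ X.ordMap (hcomp f g) := fun x => by
  apply X.le_of_split_le
  rw [split_hcomp, split_hcomp]
  exact ⟨hf _, hg _⟩

theorem nonempty_ord_id (p : C) : Nonempty (X.ord (𝟙 p)) :=
  ⟨PartOrd.Hom.hom (X := PartOrd.of PUnit.{w₁ + 1}) (Y := X.ord (𝟙 p)) (X.mapId p).inv PUnit.unit⟩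

theorem nonempty_ord_comp {p q r : C} (u : p ⟶ q) (v : q ⟶ r) (hu : Nonempty (X.ord u))
    (hv : Nonempty (X.ord v)) : Nonempty (X.ord (u ≫ v)) :=
  let ⟨x⟩ := hu
  let ⟨y⟩ := hv
  ⟨X.join u v (x, y)⟩

end Basic

section Co

variable {C : Type v₁} [Bicategory.{v₃, v₂} C] (Y : OrdFunctor.{w₂} (Co C))

theorem coMap_comp {p q : C} {u v w : p ⟶ q} (f : u ⟶ v) (g : v ⟶ w) (y : Y.coOrd w) :
    Y.coMap (f ≫ g) y = Y.coMap f (Y.coMap g y) :=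
  Y.ordMap_comp (p := .of p) (q := .of q) (u := Opposite.op w) (v := Opposite.op v)
    (w := Opposite.op u) g.op f.op y

theorem coSplit_whiskerLeft {p q r : C} (w : p ⟶ q) {u v : q ⟶ r} (f : u ⟶ v)
    (y : Y.coOrd (w ≫ v)) :
    Y.coSplit w u (Y.coMap (w ◁ f) y) =
      ((Y.coSplit w v y).1, Y.coMap f (Y.coSplit w v y).2) :=
  Y.split_whiskerLeft (p := .of p) (q := .of q) (r := .of r) (Opposite.op w)
    (u := Opposite.op v) (v := Opposite.op u) f.op y

theorem coSplit_whiskerRight {p q r : C} {u v : p ⟶ q} (f : u ⟶ v) (w : q ⟶ r)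
    (y : Y.coOrd (v ≫ w)) :
    Y.coSplit u w (Y.coMap (f ▷ w) y) =
      (Y.coMap f (Y.coSplit v w y).1, (Y.coSplit v w y).2) :=
  Y.split_whiskerRight (p := .of p) (q := .of q) (r := .of r)
    (u := Opposite.op v) (v := Opposite.op u) f.op (Opposite.op w) y

theorem coSplit_hcomp {p q r : C} {u v : p ⟶ q} {u' v' : q ⟶ r} (f : u ⟶ v) (g : u' ⟶ v')
    (y : Y.coOrd (v ≫ v')) :
    Y.coSplit u u' (Y.coMap (hcomp f g) y) =
      (Y.coMap f (Y.coSplit v v' y).1, Y.coMap g (Y.coSplit v v' y).2) := by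
  rw [hcomp, coMap_comp, coSplit_whiskerRight, coSplit_whiskerLeft]

theorem le_of_coSplit_le {p q r : C} {u : p ⟶ q} {v : q ⟶ r} {x y : Y.coOrd (u ≫ v)}
    (h : Y.coSplit u v x ≤ Y.coSplit u v y) : x ≤ y :=
  Y.le_of_split_le (p := .of p) (q := .of q) (r := .of r) (u := Opposite.op u)
    (v := Opposite.op v) h

theorem coMap_comp_le {p q : C} {u v w : p ⟶ q} {f f' : u ⟶ v} {g g' : v ⟶ w}
    (hf : Y.coMap f' ≤ Y.coMap f) (hg : Y.coMap g' ≤ Y.coMap g) :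
    Y.coMap (f' ≫ g') ≤ Y.coMap (f ≫ g) := fun y => by
  rw [coMap_comp, coMap_comp]
  exact ((Y.coMap f').monotone (hg y)).trans (hf _)

theorem coMap_hcomp_le {p q r : C} {u v : p ⟶ q} {u' v' : q ⟶ r} {f f' : u ⟶ v}
    {g g' : u' ⟶ v'} (hf : Y.coMap f' ≤ Y.coMap f) (hg : Y.coMap g' ≤ Y.coMap g) :
    Y.coMap (hcomp f' g') ≤ Y.coMap (hcomp f g) := fun y => by
  apply Y.le_of_coSplit_le
  rw [coSplit_hcomp, coSplit_hcomp]
  exact ⟨hf _, hg _⟩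

end Co

section Free

variable {S : Polygraph₂.{u₀, u₁, u₂}}

theorem nonempty_ord_of_gen₁ (X : OrdFunctor.{w₁} S.Free)
    (hX : ∀ {p q : S.Cell₀} (a : S.Cell₁ p q), Nonempty (X.ord (Polygraph₂.Free.gen₁ a)))
    {p q : S.Free} (u : p ⟶ q) : Nonempty (X.ord u) := by
  obtain ⟨p⟩ := p
  obtain ⟨q⟩ := q
  change Quiver.Path p q at u
  induction u with
  | nil => exact X.nonempty_ord_id (.of p)
  | @cons b c u a ih =>
    exact X.nonempty_ord_comp (p := .of p) (q := .of b) (r := .of c) u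
      (Polygraph₂.Free.gen₁ a) ih (hX a)

theorem nonempty_coOrd_of_gen₁ (Y : OrdFunctor.{w₂} (Co S.Free))
    (hY : ∀ {p q : S.Cell₀} (a : S.Cell₁ p q), Nonempty (Y.coOrd (Polygraph₂.Free.gen₁ a)))
    {p q : S.Free} (u : p ⟶ q) : Nonempty (Y.coOrd u) := by
  obtain ⟨p⟩ := p
  obtain ⟨q⟩ := q
  change Quiver.Path p q at u
  induction u with
  | nil => exact Y.nonempty_ord_id (.of (.of p))
  | @cons b c u a ih =>
    exact Y.nonempty_ord_comp (p := .of (.of p)) (q := .of (.of b)) (r := .of (.of c))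
      (Opposite.op u) (Opposite.op (Polygraph₂.Free.gen₁ a)) ih (hY a)

end Free

end OrdFunctor

/-! ### Values of a derivation -/

section Derivations

variable {C : Type v₁} [Bicategory.{v₃, v₂} C] {X : OrdFunctor.{w₁} C}
  {Y : OrdFunctor.{w₂} (Co C)} {G : Type w₃} [PartialOrder G]

theorem ModXYG.eval_mono {p q : C} {u v : p ⟶ q} {f : u ⟶ v} (a : ModXYG X Y G f)
    {x x' : X.ord u} {y y' : Y.coOrd v} (hx : x ≤ x') (hy : y ≤ y') :
    a.eval x y ≤ a.eval x' y' :=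
  OrderHom.monotone a ⟨hx, hy⟩

variable [AddCommGroup G] [IsOrderedAddMonoid G] (D : Derivation₂ X Y G)

namespace Derivation₂

theorem eval_comp {p q : C} {u v w : p ⟶ q} (f : u ⟶ v) (g : v ⟶ w) (x : X.ord u)
    (y : Y.coOrd w) :
    (D.d (f ≫ g)).eval x y =
      (D.d g).eval (X.ordMap f x) y + (D.d f).eval x (Y.coMap g y) := by
  rw [D.d_comp₁]
  rfl

theorem eval_hcomp {p q r : C} {u v : p ⟶ q} {u' v' : q ⟶ r} (f : u ⟶ v) (g : u' ⟶ v')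
    (x : X.ord (u ≫ u')) (y : Y.coOrd (v ≫ v')) :
    (D.d (hcomp f g)).eval x y =
      (D.d g).eval (X.split u u' x).2 (Y.coSplit v v' y).2 +
        (D.d f).eval (X.split u u' x).1 (Y.coSplit v v' y).1 := by
  rw [D.d_comp₀]
  change (D.d g).eval (X.split v u' (X.ordMap (f ▷ u') x)).2 (Y.coSplit v v' y).2 +
    (D.d f).eval (X.split u u' x).1 (Y.coSplit v u' (Y.coMap (v ◁ g) y)).1 = _
  rw [X.split_whiskerRight, Y.coSplit_whiskerLeft]

end Derivation₂

end Derivations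

/-! ### The effect of a 3-cell -/

namespace Polygraph₃

variable {S : Polygraph₃.{u₀, u₁, u₂, u₃}}

namespace Term

theorem ordMap_le (X : OrdFunctor.{w₁} S.Free₂)
    (hXα : ∀ {p q : S.Free₂} {u v : p ⟶ q} {f g : u ⟶ v}, S.Cell₃ f g → X.ordMap g ≤ X.ordMap f)
    {p q : S.Free₂} {u v : p ⟶ q} {f g : u ⟶ v} (A : S.Term f g) : X.ordMap g ≤ X.ordMap f := by
  induction A with
  | gen α => exact hXα α
  | id f => exact le_rfl
  | comp₂ A B hA hB => exact hB.trans hA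
  | comp₁ A B hA hB => exact X.ordMap_comp_le hA hB
  | comp₀ A B hA hB => exact X.ordMap_hcomp_le hA hB

theorem coMap_le (Y : OrdFunctor.{w₂} (Co S.Free₂))
    (hYα : ∀ {p q : S.Free₂} {u v : p ⟶ q} {f g : u ⟶ v}, S.Cell₃ f g → Y.coMap g ≤ Y.coMap f)
    {p q : S.Free₂} {u v : p ⟶ q} {f g : u ⟶ v} (A : S.Term f g) : Y.coMap g ≤ Y.coMap f := by
  induction A with
  | gen α => exact hYα α
  | id f => exact le_rfl
  | comp₂ A B hA hB => exact hB.trans hA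
  | comp₁ A B hA hB => exact Y.coMap_comp_le hA hB
  | comp₀ A B hA hB => exact Y.coMap_hcomp_le hA hB

/-- A term is degenerate when it represents an identity 3-cell. As `Rel` relates terms with
different boundaries, no transport along `f = g` is needed. -/
def Degenerate {p q : S.Free₂} {u v : p ⟶ q} {f g : u ⟶ v} (A : S.Term f g) : Prop :=
  f = g ∧ S.Rel A (.id f)

theorem Degenerate.isDegenerate {p q : S.Free₂} {u v : p ⟶ q} {f g : u ⟶ v} {A : S.Term f g}
    (h : A.Degenerate) : IsDegenerate (Quot.mk _ A : S.Hom₃ f g) := by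
  obtain ⟨rfl, h⟩ := h
  exact ⟨rfl, Quot.sound h⟩

theorem Degenerate.comp₂ {p q : S.Free₂} {u v : p ⟶ q} {f g h : u ⟶ v} {A : S.Term f g}
    {B : S.Term g h} (hA : A.Degenerate) (hB : B.Degenerate) : (A.comp₂ B).Degenerate := by
  obtain ⟨rfl, hA⟩ := hA
  obtain ⟨rfl, hB⟩ := hB
  exact ⟨rfl, .trans (.congr₂ hA hB) (.id_comp₂ _)⟩

theorem Degenerate.comp₁ {p q : S.Free₂} {u v w : p ⟶ q} {f f' : u ⟶ v} {g g' : v ⟶ w}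
    {A : S.Term f f'} {B : S.Term g g'} (hA : A.Degenerate) (hB : B.Degenerate) :
    (A.comp₁ B).Degenerate := by
  obtain ⟨rfl, hA⟩ := hA
  obtain ⟨rfl, hB⟩ := hB
  exact ⟨rfl, .trans (.congr₁ hA hB) (.id_comp₁_id _ _)⟩

theorem Degenerate.comp₀ {p q r : S.Free₂} {u v : p ⟶ q} {x y : q ⟶ r} {f f' : u ⟶ v}
    {g g' : x ⟶ y} {A : S.Term f f'} {B : S.Term g g'} (hA : A.Degenerate)
    (hB : B.Degenerate) : (A.comp₀ B).Degenerate := by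
  obtain ⟨rfl, hA⟩ := hA
  obtain ⟨rfl, hB⟩ := hB
  exact ⟨rfl, .trans (.congr₀ hA hB) (.id_comp₀_id _ _)⟩

variable {X : OrdFunctor.{w₁} S.Free₂} {Y : OrdFunctor.{w₂} (Co S.Free₂)} {G : Type w₃}
  [AddCommGroup G] [PartialOrder G] [IsOrderedAddMonoid G]

/-- A 3-cell which is not an identity makes the derivation decrease strictly at *every* point;
this uniformity is what lets the strict inequality survive in the composites, where `d` is
evaluated at other points. -/
theorem degenerate_or_lt
    (hXα : ∀ {p q : S.Free₂} {u v : p ⟶ q} {f g : u ⟶ v}, S.Cell₃ f g → X.ordMap g ≤ X.ordMap f)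
    (hYα : ∀ {p q : S.Free₂} {u v : p ⟶ q} {f g : u ⟶ v}, S.Cell₃ f g → Y.coMap g ≤ Y.coMap f)
    (D : Derivation₂ X Y G)
    (hDα : ∀ {p q : S.Free₂} {u v : p ⟶ q} {f g : u ⟶ v}, S.Cell₃ f g →
      ∀ (x : X.ord u) (y : Y.coOrd v), (D.d g).eval x y < (D.d f).eval x y)
    {p q : S.Free₂} {u v : p ⟶ q} {f g : u ⟶ v} (A : S.Term f g) :
    A.Degenerate ∨ ∀ (x : X.ord u) (y : Y.coOrd v), (D.d g).eval x y < (D.d f).eval x y := by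
  -- The induction hypothesis gives the weak inequality in both of its cases.
  have le_of {p q : S.Free₂} {u v : p ⟶ q} {f g : u ⟶ v} {A : S.Term f g}
      (h : A.Degenerate ∨ ∀ (x : X.ord u) (y : Y.coOrd v), (D.d g).eval x y < (D.d f).eval x y)
      (x : X.ord u) (y : Y.coOrd v) : (D.d g).eval x y ≤ (D.d f).eval x y := by
    obtain ⟨rfl, -⟩ | h := h
    exacts [le_rfl, (h x y).le]
  induction A with
  | gen α => exact .inr (hDα α)
  | id f => exact .inl ⟨rfl, .refl _⟩
  | comp₂ A B hA hB =>
    have leA := le_of hA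
    have leB := le_of hB
    rcases hA with hA | hA
    · rcases hB with hB | hB
      · exact .inl (hA.comp₂ hB)
      · exact .inr fun x y => (hB x y).trans_le (leA x y)
    · exact .inr fun x y => (leB x y).trans_lt (hA x y)
  | @comp₁ _ _ _ _ _ f f' g g' A B hA hB =>
    have hX := A.ordMap_le X hXα
    have hY := B.coMap_le Y hYα
    have leA := le_of hA
    have leB := le_of hB
    rcases hA with hA | hA
    · rcases hB with hB | hB
      · exact .inl (hA.comp₁ hB)
      · refine .inr fun x y => ?_
        rw [D.eval_comp, D.eval_comp]
        exact add_lt_add_of_lt_of_le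
          (((D.d g').eval_mono (hX x) le_rfl).trans_lt (hB _ y))
          (((D.d f').eval_mono le_rfl (hY y)).trans (leA x _))
    · refine .inr fun x y => ?_
      rw [D.eval_comp, D.eval_comp]
      exact add_lt_add_of_le_of_lt
        (((D.d g').eval_mono (hX x) le_rfl).trans (leB _ y))
        (((D.d f').eval_mono le_rfl (hY y)).trans_lt (hA x _))
  | comp₀ A B hA hB =>
    have leA := le_of hA
    have leB := le_of hB
    rcases hA with hA | hA
    · rcases hB with hB | hB
      · exact .inl (hA.comp₀ hB)
      · refine .inr fun x y => ?_
        rw [D.eval_hcomp, D.eval_hcomp]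
        exact add_lt_add_of_lt_of_le (hB _ _) (leA _ _)
    · refine .inr fun x y => ?_
      rw [D.eval_hcomp, D.eval_hcomp]
      exact add_lt_add_of_le_of_lt (leB _ _) (hA _ _)

end Term

end Polygraph₃

/-! ### Termination -/

theorem mainTheorem9 (S : Polygraph₃.{u₀, u₁, u₂, u₃})
    (X : OrdFunctor.{w₁} S.Free₂) (Y : OrdFunctor.{w₂} (Co S.Free₂))
    (hX : ∀ {p q : S.Cell₀} (a : S.Cell₁ p q), Nonempty (X.ord (Polygraph₂.Free.gen₁ a)))
    (hY : ∀ {p q : S.Cell₀} (a : S.Cell₁ p q), Nonempty (Y.coOrd (Polygraph₂.Free.gen₁ a)))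
    (hXα : ∀ {p q : S.Free₂} {u v : p ⟶ q} {f g : u ⟶ v}, S.Cell₃ f g → X.ordMap g ≤ X.ordMap f)
    (hYα : ∀ {p q : S.Free₂} {u v : p ⟶ q} {f g : u ⟶ v}, S.Cell₃ f g → Y.coMap g ≤ Y.coMap f)
    (G : Type w₃) [AddCommGroup G] [PartialOrder G] [IsOrderedAddMonoid G]
    (hG : ∀ s : ℕ → G, Antitone s → (∀ n, 0 ≤ s n) → ∃ N, ∀ n, N ≤ n → s n = s N)
    (D : Derivation₂ X Y G)
    (hD : ∀ {p q : S.Free₂} {u v : p ⟶ q} (f : u ⟶ v) (x : X.ord u) (y : Y.coOrd v),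
      0 ≤ (D.d f).eval x y)
    (hDα : ∀ {p q : S.Free₂} {u v : p ⟶ q} {f g : u ⟶ v}, S.Cell₃ f g →
      ∀ (x : X.ord u) (y : Y.coOrd v), (D.d g).eval x y < (D.d f).eval x y) :
    S.Terminates := by

  rintro p q u v f ⟨F, -, hF⟩
  obtain ⟨x⟩ := X.nonempty_ord_of_gen₁ hX u
  obtain ⟨y⟩ := Y.nonempty_coOrd_of_gen₁ hY v
  have hs : StrictAnti fun n => (D.d (F n)).eval x y := by
    refine strictAnti_nat_of_succ_lt fun n => ?_
    obtain ⟨⟨A⟩, hA⟩ := hF n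
    exact (A.degenerate_or_lt hXα hYα D hDα).resolve_left (fun h => hA h.isDegenerate) x y
  obtain ⟨N, hN⟩ := hG _ hs.antitone fun n => hD (F n) x y
  exact (hs N.lt_succ_self).ne (hN (N + 1) N.le_succ)
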